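/- Let $1<p<\infty$ and let $L_p=L_p[0,1]$ be the real space with Lebesgue measure; relations between sets are understood up to null sets. **Operators.** $\mathcal D^n$ is the set of dyadic intervals $[\frac{i-1}{2^n},\frac{i}{2^n})$, $1\le i\le 2^n$, and $\mathcal D=\bigcup_{n\ge 0}\mathcal D^n$. For $I=[a,b)\in\mathcal D$ let $T_I:L_p\to L_p$ be given by $(T_If)(t)=f\big(\frac{t-a}{b-a}\big)$ for $t\in I$ and $(T_If)(t)=0$ otherwise. A linear operator $T:L_p\to L_p$ is a *distributional embedding* if $Tf$ and $f$ have the same distribution for every $f\in L_p$. For every limit ordinal $\alpha<\omega_1$ fix any distributional embeddings $T^\alpha_\beta:L_p\to L_p$, $0\le\beta<\alpha$, with independent ranges, i.e. for every family $(f_\beta)_{\beta<\alpha}$ in $L_p$ the functions $(T^\alpha_\beta f_\beta)_{\beta<\alpha}$ are independent. Let $L_p^{n,0}$ be the space of mean-zero functions in the linear span of $\{\chi_I: I\in\mathcal D^n\}$. **Trees.** For an ordinal $\alpha$ let $\kappa(\alpha)=0$ if $\alpha$ is $0$ or a limit ordinal, and $\kappa(\alpha+1)=\kappa(\alpha)+1$.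 For $1\le\alpha<\omega_1$ the set $\mathcal T_\alpha$ of finite sequences of ordinals and dyadic intervals is defined recursively: $\mathcal T_n=\{(n)\}$ for $1\le n<\omega$; $\mathcal T_\alpha=\bigcup_{1\le\beta<\alpha}\{(\alpha)^\frown\lambda:\lambda\in\mathcal T_\beta\}$ for $\alpha$ a limit ordinal; and $\mathcal T_\alpha=\{(\alpha)\}\cup\bigcup_{I\in\mathcal D^{\kappa(\alpha)}}\{(\alpha,I)^\frown\lambda:\lambda\in\mathcal T_\beta\}$ if $\alpha=\beta+\kappa(\alpha)$ is an infinite successor ordinal, $\beta$ being a limit ordinal. Two members of $\mathcal T_\alpha$ are *incomparable* if neither is an initial segment of the other. **Spaces.** For $\lambda\in\mathcal T_\alpha$ define $T_\lambda:L_p\to L_p$ recursively by $T_{(\alpha)}=\mathrm{id}$; $T_{(\alpha)^\frown\mu}=T^\alpha_\beta T_\mu$ if $\alpha$ is a limit ordinal and $\mu\in\mathcal T_\beta$, $1\le\beta<\alpha$; and $T_{(\alpha,I)^\frown\mu}=T_IT_\mu$ if $\alpha=\beta+\kappa(\alpha)$ is an infinite successor ordinal, $I\in\mathcal D^{\kappa(\alpha)}$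 and $\mu\in\mathcal T_\beta$. Put $\kappa(\lambda)=\kappa(x_l)$, where the ordinal $x_l$ is the last entry of $\lambda$, and $X_\lambda=T_\lambda(L_p^{\kappa(\lambda),0})$. For a subspace $X$ of $L_p$, $\mathrm{supp}(X)$ is the essentially smallest measurable $A\subset[0,1]$ such that $[f\ne0]\subset A$ for every $f\in X$. Two members $\lambda,\mu$ of $\mathcal T_\alpha$ are *disjointly supported* if $\mathrm{supp}(X_\lambda)\cap\mathrm{supp}(X_\mu)=\emptyset$. **Proposition.** Let $1\le\alpha<\omega_1$, let $\lambda,\mu\in\mathcal T_\alpha$ be incomparable, and let $i_0=\min\{i:\lambda(i)\ne\mu(i)\}$. Then (a) the entries $\lambda(i_0)$ and $\mu(i_0)$ are either both ordinals or both dyadic intervals; (b) $\lambda$ and $\mu$ are disjointly supported if and only if $\lambda(i_0)$ and $\mu(i_0)$ are both intervals. -/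

import Mathlib

open MeasureTheory ProbabilityTheory Set
open scoped ENNReal Ordinal

namespace BRS

/-! ### Dyadic intervals, the space `L_p = L_p[0,1]`, and the operators `T_I` -/

/-- The dyadic interval `[index / 2 ^ level, (index + 1) / 2 ^ level)` of `[0, 1]`. Distinct pairs
`(level, index)` give distinct intervals, so this type is the set `𝓓` of dyadic intervals, and
`I.level = n` means `I ∈ 𝓓ⁿ`. -/
structure Dyadic where
  level : ℕ
  index : Fin (2 ^ level)

namespace Dyadic

noncomputable def left (I : Dyadic) : ℝ := (I.index : ℕ) / 2 ^ I.level

noncomputable def right (I : Dyadic) : ℝ := ((I.index : ℕ) + 1) / 2 ^ I.level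

/-- The interval as a set of reals. -/
def toSet (I : Dyadic) : Set ℝ := Ico I.left I.right

theorem left_nonneg (I : Dyadic) : 0 ≤ I.left := by
  unfold left; positivity

theorem left_lt_right (I : Dyadic) : I.left < I.right := by
  unfold left right
  exact div_lt_div_of_pos_right (by linarith) (by positivity)

theorem right_le_one (I : Dyadic) : I.right ≤ 1 := by
  unfold right
  rw [div_le_one (by positivity)]
  have h : (I.index : ℕ) + 1 ≤ 2 ^ I.level := I.index.2
  exact_mod_cast h

theorem measurableSet_toSet (I : Dyadic) : MeasurableSet I.toSet := measurableSet_Ico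

end Dyadic

/-- Lebesgue measure on `[0, 1]`. -/
noncomputable abbrev unitMeasure : Measure ℝ := volume.restrict (Icc 0 1)

instance : IsProbabilityMeasure unitMeasure :=
  ⟨by simp [unitMeasure]⟩

/-- The real space `L_p = L_p[0,1]`. -/
noncomputable abbrev LpUnit (p : ℝ≥0∞) : Type := Lp ℝ p unitMeasure

/-- For `I = [a, b)`, the function equal to `f ((t - a) / (b - a))` on `I` and to `0` elsewhere. -/
noncomputable def compressFun (I : Dyadic) (f : ℝ → ℝ) : ℝ → ℝ :=
  I.toSet.indicator fun t => f ((t - I.left) / (I.right - I.left))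

theorem map_rescale (I : Dyadic) :
    Measure.map (fun t : ℝ => (t - I.left) / (I.right - I.left)) volume
      = ENNReal.ofReal (I.right - I.left) • volume := by
  have hc : 0 < I.right - I.left := sub_pos.2 I.left_lt_right
  have h1 : (fun t : ℝ => (t - I.left) / (I.right - I.left))
      = (fun t => (I.right - I.left)⁻¹ * t) ∘ fun t => t + -I.left := by
    funext t; simp [div_eq_inv_mul, sub_eq_add_neg]
  rw [h1, ← Measure.map_map (by fun_prop) (by fun_prop), map_add_right_eq_self,
    Real.map_volume_mul_left (inv_ne_zero hc.ne')]
  simp [abs_of_pos hc]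

theorem rescale_mem (I : Dyadic) {t : ℝ} (ht : t ∈ I.toSet) :
    (t - I.left) / (I.right - I.left) ∈ Icc (0 : ℝ) 1 := by
  have hc : 0 < I.right - I.left := sub_pos.2 I.left_lt_right
  have h1 : I.left ≤ t := ht.1
  have h2 : t < I.right := ht.2
  exact ⟨div_nonneg (by linarith) hc.le, (div_le_one hc).2 (by linarith)⟩

theorem compressFun_congr (I : Dyadic) {f g : ℝ → ℝ} (h : f =ᵐ[unitMeasure] g) :
    compressFun I f =ᵐ[unitMeasure] compressFun I g := by
  apply ae_restrict_of_ae
  have h' : ∀ᵐ s ∂(volume : Measure ℝ), s ∈ Icc (0 : ℝ) 1 → f s = g s :=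
    (ae_restrict_iff' measurableSet_Icc).1 h
  have hm : Measurable fun t : ℝ => (t - I.left) / (I.right - I.left) := by fun_prop
  have h2 : ∀ᵐ s ∂(Measure.map (fun t : ℝ => (t - I.left) / (I.right - I.left)) volume),
      s ∈ Icc (0 : ℝ) 1 → f s = g s := by
    rw [map_rescale]
    exact Measure.ae_smul_measure h' _
  filter_upwards [ae_of_ae_map hm.aemeasurable h2] with t ht
  by_cases hI : t ∈ I.toSet
  · simp only [compressFun, indicator_of_mem hI]
    exact ht (rescale_mem I hI)
  · simp only [compressFun, indicator_of_notMem hI]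

theorem memLp_compressFun {p : ℝ≥0∞} (I : Dyadic) {f : ℝ → ℝ} (hf : MemLp f p unitMeasure) :
    MemLp (compressFun I f) p unitMeasure := by
  have hm : Measurable fun t : ℝ => (t - I.left) / (I.right - I.left) := by fun_prop
  have h1 : MemLp ((Icc (0 : ℝ) 1).indicator f) p volume :=
    (memLp_indicator_iff_restrict measurableSet_Icc).2 hf
  have h2 : MemLp ((Icc (0 : ℝ) 1).indicator f) p
      (Measure.map (fun t : ℝ => (t - I.left) / (I.right - I.left)) volume) := by
    rw [map_rescale]
    exact h1.smul_measure ENNReal.ofReal_ne_top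
  have h3 := (h2.comp_of_map hm.aemeasurable).indicator I.measurableSet_toSet
  have h4 : I.toSet.indicator (((Icc (0 : ℝ) 1).indicator f) ∘
      fun t : ℝ => (t - I.left) / (I.right - I.left)) = compressFun I f := by
    funext t
    by_cases hI : t ∈ I.toSet
    · simp only [compressFun, indicator_of_mem hI, Function.comp_apply,
        indicator_of_mem (rescale_mem I hI)]
    · simp only [compressFun, indicator_of_notMem hI]
  rw [h4] at h3
  exact h3.restrict _

/-- The operator `T_I : L_p → L_p`, `T_I f (t) = f ((t - a) / (b - a))` for `t ∈ I = [a, b)` and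
`T_I f (t) = 0` otherwise. -/
noncomputable def compress (p : ℝ≥0∞) (I : Dyadic) : LpUnit p →ₗ[ℝ] LpUnit p where
  toFun f := (memLp_compressFun I (Lp.memLp f)).toLp
  map_add' f g := by
    rw [← MemLp.toLp_add]
    apply MemLp.toLp_congr
    refine (compressFun_congr I (Lp.coeFn_add f g)).trans (Filter.Eventually.of_forall fun t => ?_)
    simp only [compressFun, Pi.add_apply]
    by_cases hI : t ∈ I.toSet <;> simp [hI]
  map_smul' c f := by
    rw [RingHom.id_apply, ← MemLp.toLp_const_smul]
    apply MemLp.toLp_congr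
    refine (compressFun_congr I (Lp.coeFn_smul c f)).trans (Filter.Eventually.of_forall fun t => ?_)
    simp only [compressFun, Pi.smul_apply]
    by_cases hI : t ∈ I.toSet <;> simp [hI]

/-- `L_p^n`, the span of the characteristic functions of the dyadic intervals of length `2⁻ⁿ`. -/
noncomputable def LpLevel (p : ℝ≥0∞) (n : ℕ) : Submodule ℝ (LpUnit p) :=
  Submodule.span ℝ {f | ∃ I : Dyadic, I.level = n ∧
    f = indicatorConstLp p I.measurableSet_toSet (measure_ne_top unitMeasure I.toSet) (1 : ℝ)}

/-- `L_p^0`, the functions of mean zero. -/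
noncomputable def LpMeanZero (p : ℝ≥0∞) [hp : Fact (1 ≤ p)] : Submodule ℝ (LpUnit p) where
  carrier := {f | ∫ t, f t ∂unitMeasure = 0}
  zero_mem' := by
    show ∫ t, (0 : LpUnit p) t ∂unitMeasure = 0
    rw [integral_congr_ae (Lp.coeFn_zero ℝ p unitMeasure)]
    simp
  add_mem' := by
    intro f g hf hg
    simp only [mem_ofPred_eq] at hf hg ⊢
    rw [integral_congr_ae (Lp.coeFn_add f g)]
    simp only [Pi.add_apply]
    rw [integral_add ((Lp.memLp f).integrable hp.out) ((Lp.memLp g).integrable hp.out), hf, hg,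
      add_zero]
  smul_mem' := by
    intro c f hf
    simp only [mem_ofPred_eq] at hf ⊢
    rw [integral_congr_ae (Lp.coeFn_smul c f)]
    simp only [Pi.smul_apply, integral_smul, hf, smul_zero]

/-- `L_p^{n,0}`, the functions of mean zero in `L_p^n`. -/
noncomputable def LpLevelZero (p : ℝ≥0∞) [Fact (1 ≤ p)] (n : ℕ) : Submodule ℝ (LpUnit p) :=
  LpLevel p n ⊓ LpMeanZero p

/-! ### The families `(T_β^α)` of distributional embeddings with independent ranges -/

/-- A linear operator on `L_p` that preserves the distribution of every function. -/
def IsDistributionalEmbedding {p : ℝ≥0∞} (T : LpUnit p →ₗ[ℝ] LpUnit p) : Prop :=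
  ∀ f : LpUnit p, Measure.map (T f) unitMeasure = Measure.map f unitMeasure

/-- A choice, for every limit ordinal `α < ω₁`, of distributional embeddings
`T α β = T_β^α : L_p → L_p`, `0 ≤ β < α`, with independent ranges. The values of `T` at other
pairs of ordinals are irrelevant. -/
structure IsIndependentSystem {p : ℝ≥0∞}
    (T : Ordinal.{0} → Ordinal.{0} → LpUnit p →ₗ[ℝ] LpUnit p) : Prop where
  embedding : ∀ α < ω₁, Order.IsSuccLimit α → ∀ β < α, IsDistributionalEmbedding (T α β)
  independent : ∀ α < ω₁, Order.IsSuccLimit α → ∀ f : Iio α → LpUnit p,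
    iIndepFun (fun (β : Iio α) (t : ℝ) => T α β (f β) t) unitMeasure

/-! ### The trees `𝓣_α` -/

/-- The integer part `κ(α)`: it is `0` at `0` and at limit ordinals, and `κ(α + 1) = κ(α) + 1`. -/
noncomputable def kappa (α : Ordinal.{0}) : ℕ :=
  Ordinal.limitRecOn α 0 (fun _ k => k + 1) (fun _ _ _ => 0)

/-- An entry of a sequence in a tree: an ordinal or a dyadic interval. -/
inductive Entry where
  | ord (α : Ordinal.{0})
  | itv (I : Dyadic)

/-- `Tree α s` says that the finite sequence `s` belongs to the tree `𝓣_α`: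
* `𝓣_n = {(n)}` for `1 ≤ n < ω`;
* `𝓣_α` consists of the `(α)⌢s`, `s ∈ 𝓣_β`, `1 ≤ β < α`, when `α` is a limit ordinal;
* `𝓣_α` consists of `(α)` and the `(α, I)⌢s`, `I ∈ 𝓓^κ(α)`, `s ∈ 𝓣_β`, when `α = β + κ(α)` is an
  infinite successor ordinal. -/
inductive Tree : Ordinal.{0} → List Entry → Prop where
  | finite (n : ℕ) (hn : 1 ≤ n) : Tree n [.ord n]
  | limit {α β : Ordinal.{0}} {s : List Entry} (hα : Order.IsSuccLimit α) (h1 : 1 ≤ β)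
      (hβ : β < α) (hs : Tree β s) : Tree α (.ord α :: s)
  | head {α β : Ordinal.{0}} (hβ : Order.IsSuccLimit β) (hα : α = β + kappa α)
      (hκ : 1 ≤ kappa α) : Tree α [.ord α]
  | branch {α β : Ordinal.{0}} {I : Dyadic} {s : List Entry} (hβ : Order.IsSuccLimit β)
      (hα : α = β + kappa α) (hκ : 1 ≤ kappa α) (hI : I.level = kappa α) (hs : Tree β s) :
      Tree α (.ord α :: .itv I :: s)

/-- Two sequences are incomparable for the initial-segment order. -/
def Incomparable (s t : List Entry) : Prop := ¬ s <+: t ∧ ¬ t <+: s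

/-! ### The operators `T_λ`, the spaces `X_λ` and their supports -/

/-- The operator `T_λ`: `T_(α) = id`, `T_{(α)⌢μ} = T_β^α T_μ` when `μ` begins with the ordinal `β`
(that is, `μ ∈ 𝓣_β`), and `T_{(α,I)⌢μ} = T_I T_μ`. The last two cases never occur in a tree. -/
noncomputable def treeOp {p : ℝ≥0∞} (T : Ordinal.{0} → Ordinal.{0} → LpUnit p →ₗ[ℝ] LpUnit p) :
    List Entry → (LpUnit p →ₗ[ℝ] LpUnit p)
  | [.ord _] => LinearMap.id
  | .ord α :: .ord β :: s => T α β ∘ₗ treeOp T (.ord β :: s)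
  | .ord _ :: .itv I :: s => compress p I ∘ₗ treeOp T s
  | .itv _ :: _ => LinearMap.id
  | [] => LinearMap.id

/-- `κ(λ) = κ(x_l)`, where the ordinal `x_l` is the last entry of `λ`. -/
noncomputable def lastKappa (s : List Entry) : ℕ :=
  match s.getLast? with
  | some (.ord α) => kappa α
  | _ => 0

/-- `X_λ = T_λ (L_p^{κ(λ),0})`. -/
noncomputable def XSpace {p : ℝ≥0∞} [Fact (1 ≤ p)]
    (T : Ordinal.{0} → Ordinal.{0} → LpUnit p →ₗ[ℝ] LpUnit p) (s : List Entry) :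
    Submodule ℝ (LpUnit p) :=
  (LpLevelZero p (lastKappa s)).map (treeOp T s)

/-- `supp(X) ⊂ A`: the measurable set `A ⊆ [0, 1]` essentially contains `[f ≠ 0]` for all
`f ∈ X`. -/
def SuppSubset {p : ℝ≥0∞} (X : Submodule ℝ (LpUnit p)) (A : Set ℝ) : Prop :=
  MeasurableSet A ∧ A ⊆ Icc 0 1 ∧ ∀ f ∈ X, unitMeasure ({t | f t ≠ 0} \ A) = 0

/-- `supp(X) = A`: the set `A` is essentially the least one with `supp(X) ⊂ A`. -/
def IsSupp {p : ℝ≥0∞} (X : Submodule ℝ (LpUnit p)) (A : Set ℝ) : Prop :=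
  SuppSubset X A ∧ ∀ B, SuppSubset X B → unitMeasure (A \ B) = 0

theorem exists_isSupp {p : ℝ≥0∞} (X : Submodule ℝ (LpUnit p)) : ∃ A, IsSupp X A := by
  let m : Set ℝ≥0∞ := {r | ∃ A, SuppSubset X A ∧ unitMeasure A = r}
  have hne : m.Nonempty := by
    refine ⟨_, Icc 0 1, ⟨measurableSet_Icc, le_rfl, fun f _ => ?_⟩, rfl⟩
    have h : unitMeasure (Icc (0 : ℝ) 1)ᶜ = 0 := by
      rw [Measure.restrict_apply measurableSet_Icc.compl]; simp
    exact measure_mono_null (fun t ht => ht.2) h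
  obtain ⟨u, -, hu, hum⟩ := exists_seq_tendsto_sInf hne (OrderBot.bddBelow m)
  choose A hA hAu using hum
  have hS : SuppSubset X (⋂ n, A n) := by
    refine ⟨MeasurableSet.iInter fun n => (hA n).1, (iInter_subset A 0).trans (hA 0).2.1,
      fun f hf => ?_⟩
    rw [sdiff_iInter]
    exact measure_iUnion_null fun n => (hA n).2.2 f hf
  have hle : unitMeasure (⋂ n, A n) ≤ sInf m :=
    ge_of_tendsto' hu fun n => hAu n ▸ measure_mono (iInter_subset A n)
  refine ⟨_, hS, fun B hB => ?_⟩
  have hSB : SuppSubset X ((⋂ n, A n) ∩ B) := by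
    refine ⟨hS.1.inter hB.1, inter_subset_left.trans hS.2.1, fun f hf => ?_⟩
    rw [sdiff_inter]
    exact measure_union_null (hS.2.2 f hf) (hB.2.2 f hf)
  have h1 : unitMeasure (⋂ n, A n) ≤ unitMeasure ((⋂ n, A n) ∩ B) :=
    hle.trans (sInf_le ⟨_, hSB, rfl⟩)
  have h2 := measure_inter_add_sdiff (μ := unitMeasure) (⋂ n, A n) hB.1
  have h3 : unitMeasure ((⋂ n, A n) ∩ B) + unitMeasure ((⋂ n, A n) \ B)
      ≤ unitMeasure ((⋂ n, A n) ∩ B) + 0 := by rw [h2, add_zero]; exact h1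
  exact le_antisymm ((ENNReal.add_le_add_iff_left (measure_ne_top _ _)).1 h3) bot_le

/-- The support `supp(X)` of a subspace of `L_p`, determined up to null sets. -/
noncomputable def supp {p : ℝ≥0∞} (X : Submodule ℝ (LpUnit p)) : Set ℝ := (exists_isSupp X).choose

/-- `λ` and `μ` are disjointly supported: `supp(X_λ) ∩ supp(X_μ)` is essentially empty. -/
def DisjointlySupported {p : ℝ≥0∞} [Fact (1 ≤ p)]
    (T : Ordinal.{0} → Ordinal.{0} → LpUnit p →ₗ[ℝ] LpUnit p) (s t : List Entry) : Prop :=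
  unitMeasure (supp (XSpace T s) ∩ supp (XSpace T t)) = 0

end BRS

namespace BRS

/-! ### Dyadic intervals of the same level -/

/-! Disjointness of supports is tested on pairs of functions: by `supp_inter_supp_null_iff` it means
that `overlap f g = 0` for all `f` in one space and `g` in the other. Every operator that builds
`T_λ` preserves and reflects null overlap. For `T_I` this is a change of variable; for a
distributional embedding, linearity upgrades equality of laws to equality of joint laws of pairs
(Cramér–Wold). A common initial segment can therefore be stripped off by induction on the tree.

At the first difference there are two cases. Below a limit ordinal the entries are distinct
ordinals, and nonzero functions in the independent ranges overlap with positive measure; here the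
spaces `X_λ` must be nonzero, which holds because `κ(λ) ≥ 1`. Below an infinite successor the
entries are distinct dyadic intervals of one level, hence disjoint. -/

theorem Dyadic.disjoint_of_level_eq {I J : Dyadic} (h : I.level = J.level) (hne : I ≠ J) :
    Disjoint I.toSet J.toSet := by
  obtain ⟨n, i⟩ := I
  obtain ⟨_, j⟩ := J
  obtain rfl : n = _ := h
  have key : ∀ a b : Fin (2 ^ n), a < b →
      Disjoint (Dyadic.toSet ⟨n, a⟩) (Dyadic.toSet ⟨n, b⟩) := by
    intro a b hab
    refine Set.disjoint_left.2 fun t ht ht' => ?_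
    have h1 : Dyadic.right ⟨n, a⟩ ≤ Dyadic.left ⟨n, b⟩ := by
      have h2 : ((a : ℕ) : ℝ) + 1 ≤ (b : ℕ) := by exact_mod_cast hab
      exact div_le_div_of_nonneg_right h2 (by positivity)
    exact absurd ht.2 (not_lt.2 (h1.trans ht'.1))
  rcases lt_trichotomy i j with hij | rfl | hij
  · exact key i j hij
  · exact absurd rfl hne
  · exact (key j i hij).symm

theorem Dyadic.toSet_subset_Icc (I : Dyadic) : I.toSet ⊆ Icc 0 1 := fun _ ht =>
  ⟨I.left_nonneg.trans ht.1, ht.2.le.trans I.right_le_one⟩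

theorem Dyadic.unitMeasure_toSet (I : Dyadic) :
    unitMeasure I.toSet = ENNReal.ofReal (I.right - I.left) := by
  rw [Measure.restrict_apply I.measurableSet_toSet, inter_eq_left.2 I.toSet_subset_Icc,
    Dyadic.toSet, Real.volume_Ico]

theorem Dyadic.right_sub_left (I : Dyadic) : I.right - I.left = 1 / 2 ^ I.level := by
  unfold Dyadic.right Dyadic.left
  ring

/-! ### The measure of the set where two functions are both non-zero -/

section Overlap

variable {p : ℝ≥0∞}

/-- The measure of the intersection of the supports of two functions. -/
noncomputable def overlap (f g : LpUnit p) : ℝ≥0∞ := unitMeasure {t | f t ≠ 0 ∧ g t ≠ 0}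

/-- The operator preserves whether or not two functions are disjointly supported. -/
def PreservesDisjointness (T : LpUnit p →ₗ[ℝ] LpUnit p) : Prop :=
  ∀ f g, overlap (T f) (T g) = 0 ↔ overlap f g = 0

theorem measurableSet_support (f : LpUnit p) : MeasurableSet {t | f t ≠ 0} :=
  (Lp.stronglyMeasurable f).measurable (measurableSet_singleton 0).compl

theorem overlap_self_eq_zero_iff {f : LpUnit p} : overlap f f = 0 ↔ f = 0 := by
  rw [Lp.eq_zero_iff_ae_eq_zero]
  simp only [overlap, and_self]
  exact Iff.rfl

theorem PreservesDisjointness.map_ne_zero {T : LpUnit p →ₗ[ℝ] LpUnit p}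
    (hT : PreservesDisjointness T) {f : LpUnit p} (hf : f ≠ 0) : T f ≠ 0 := fun h =>
  hf (overlap_self_eq_zero_iff.1 ((hT f f).1 (overlap_self_eq_zero_iff.2 h)))

theorem PreservesDisjointness.id :
    PreservesDisjointness (LinearMap.id : LpUnit p →ₗ[ℝ] LpUnit p) := fun _ _ => Iff.rfl

theorem PreservesDisjointness.comp {S T : LpUnit p →ₗ[ℝ] LpUnit p}
    (hS : PreservesDisjointness S) (hT : PreservesDisjointness T) :
    PreservesDisjointness (S ∘ₗ T) := fun f g => (hS _ _).trans (hT f g)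

/-! ### Distributional embeddings -/

/-- A linear map preserving distributions preserves joint distributions of pairs. -/
theorem IsDistributionalEmbedding.map_prodMk {T : LpUnit p →ₗ[ℝ] LpUnit p}
    (hT : IsDistributionalEmbedding T) (f g : LpUnit p) :
    Measure.map (fun t => (T f t, T g t)) unitMeasure
      = Measure.map (fun t => (f t, g t)) unitMeasure := by
  have hm : ∀ f g : LpUnit p, Measurable fun t => (f t, g t) := fun f g =>
    (Lp.stronglyMeasurable f).measurable.prodMk (Lp.stronglyMeasurable g).measurable
  -- Cramér–Wold: the characteristic function of the pair at `L` is that of a single linear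
  -- combination of `f` and `g` at `1`, and `T` commutes with linear combinations.
  have hchar : ∀ (f g : LpUnit p) (L : StrongDual ℝ (ℝ × ℝ)),
      charFunDual (Measure.map (fun t => (f t, g t)) unitMeasure) L
        = ∫ x, Complex.exp ((x : ℂ) * Complex.I)
            ∂(Measure.map (L (1, 0) • f + L (0, 1) • g : LpUnit p) unitMeasure) := by
    intro f g L
    rw [charFunDual_apply, integral_map (hm f g).aemeasurable
        (Continuous.aestronglyMeasurable (by fun_prop)),
      integral_map (Lp.stronglyMeasurable _).measurable.aemeasurable
        (Continuous.aestronglyMeasurable (by fun_prop))]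
    refine integral_congr_ae ?_
    filter_upwards [Lp.coeFn_add (L (1, 0) • f) (L (0, 1) • g), Lp.coeFn_smul (L (1, 0)) f,
      Lp.coeFn_smul (L (0, 1)) g] with t h1 h2 h3
    have h4 : ((f t, g t) : ℝ × ℝ) = f t • (1, 0) + g t • (0, 1) := by simp
    rw [h1, Pi.add_apply, h2, h3, h4, map_add, map_smul, map_smul]
    simp [mul_comm]
  refine Measure.ext_of_charFunDual (funext fun L => ?_)
  rw [hchar, hchar, ← map_smul, ← map_smul, ← map_add, hT]

theorem overlap_eq_map (f g : LpUnit p) :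
    overlap f g = Measure.map (fun t => (f t, g t)) unitMeasure ({0}ᶜ ×ˢ {0}ᶜ) := by
  rw [Measure.map_apply
    ((Lp.stronglyMeasurable f).measurable.prodMk (Lp.stronglyMeasurable g).measurable)
    ((measurableSet_singleton 0).compl.prod (measurableSet_singleton 0).compl)]
  rfl

theorem IsDistributionalEmbedding.preservesDisjointness {T : LpUnit p →ₗ[ℝ] LpUnit p}
    (hT : IsDistributionalEmbedding T) : PreservesDisjointness T := fun f g => by
  rw [overlap_eq_map, overlap_eq_map, hT.map_prodMk]

/-- The events `f ≠ 0` and `g ≠ 0` are independent, so the overlap is a product of two positive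
measures. -/
theorem overlap_ne_zero_of_indepFun {f g : LpUnit p} (h : IndepFun f g unitMeasure)
    (hf : f ≠ 0) (hg : g ≠ 0) : overlap f g ≠ 0 := by
  have key := h.measure_inter_preimage_eq_mul {0}ᶜ {0}ᶜ (measurableSet_singleton 0).compl
    (measurableSet_singleton 0).compl
  have hpos : ∀ f : LpUnit p, f ≠ 0 → unitMeasure (f ⁻¹' {0}ᶜ) ≠ 0 := fun f hf h0 =>
    hf (Lp.eq_zero_iff_ae_eq_zero.2 h0)
  intro h0
  exact mul_ne_zero (hpos f hf) (hpos g hg) (key.symm.trans h0)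

/-! ### The operators `T_I` -/

theorem coeFn_compress (I : Dyadic) (f : LpUnit p) :
    compress p I f =ᵐ[unitMeasure] compressFun I f :=
  MemLp.coeFn_toLp (memLp_compressFun I (Lp.memLp f))

/-- Dropping the null endpoint `1` makes the half-open `I` correspond exactly to `[0, 1)` under
rescaling. -/
theorem unitMeasure_apply_eq_volume_Ico (A : Set ℝ) :
    unitMeasure A = volume (A ∩ Ico (0 : ℝ) 1) := by
  rw [unitMeasure, Measure.restrict_congr_set Ico_ae_eq_Icc.symm,
    Measure.restrict_apply' measurableSet_Ico]

/-- The overlap of the images is the preimage of the original overlap under the affine rescaling, so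
its measure is multiplied by the positive length of `I`. -/
theorem preservesDisjointness_compress (I : Dyadic) :
    PreservesDisjointness (compress p I) := fun f g => by
  have hc : 0 < I.right - I.left := sub_pos.2 I.left_lt_right
  set S : Set ℝ := {t | f t ≠ 0 ∧ g t ≠ 0} with hS
  have hSm : MeasurableSet S := (measurableSet_support f).inter (measurableSet_support g)
  have h1 : overlap (compress p I f) (compress p I g)
      = unitMeasure {t | compressFun I f t ≠ 0 ∧ compressFun I g t ≠ 0} := by
    refine measure_congr ?_
    filter_upwards [coeFn_compress I f, coeFn_compress I g] with t hf hg
    change (_ ∧ _) = (_ ∧ _)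
    rw [hf, hg]
  have h2 : {t | compressFun I f t ≠ 0 ∧ compressFun I g t ≠ 0} ∩ Ico 0 1
      = (fun t : ℝ => (t - I.left) / (I.right - I.left)) ⁻¹' (S ∩ Ico 0 1) := by
    ext t
    have hI : t ∈ I.toSet ↔ (t - I.left) / (I.right - I.left) ∈ Ico (0 : ℝ) 1 := by
      rw [Dyadic.toSet, mem_Ico, mem_Ico, div_lt_one hc, le_div_iff₀ hc]
      constructor <;> rintro ⟨h, h'⟩ <;> constructor <;> linarith
    have h01 : t ∈ I.toSet → t ∈ Ico (0 : ℝ) 1 := fun ht =>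
      ⟨I.left_nonneg.trans ht.1, ht.2.trans_le I.right_le_one⟩
    simp only [mem_inter_iff, mem_preimage, ← hI, hS, mem_ofPred_eq, compressFun]
    by_cases ht : t ∈ I.toSet
    · simp [ht, h01 ht]
    · simp [ht]
  have hm : Measurable fun t : ℝ => (t - I.left) / (I.right - I.left) := by fun_prop
  rw [h1, unitMeasure_apply_eq_volume_Ico, h2,
    ← Measure.map_apply hm (hSm.inter measurableSet_Ico), map_rescale, Measure.smul_apply,
    smul_eq_mul, mul_eq_zero, or_iff_right (ENNReal.ofReal_pos.2 hc).ne', overlap,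
    unitMeasure_apply_eq_volume_Ico]

theorem overlap_compress_eq_zero {I J : Dyadic} (h : Disjoint I.toSet J.toSet)
    (f g : LpUnit p) : overlap (compress p I f) (compress p J g) = 0 := by
  refine measure_eq_zero_iff_ae_notMem.2 ?_
  filter_upwards [coeFn_compress I f, coeFn_compress J g] with t hf hg
  rw [hf, hg]
  rintro ⟨h1, h2⟩
  exact Set.disjoint_left.1 h (mem_of_indicator_ne_zero h1) (mem_of_indicator_ne_zero h2)

/-! ### Supports of subspaces -/

theorem supp_inter_supp_null_iff (X Y : Submodule ℝ (LpUnit p)) :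
    unitMeasure (supp X ∩ supp Y) = 0 ↔ ∀ f ∈ X, ∀ g ∈ Y, overlap f g = 0 := by
  -- If `C` meets each `[f ≠ 0]` in a null set, then `supp X \ C` still carries `X`, so minimality
  -- makes `supp X ∩ C` null. Using this once for `X` and once for `Y` passes from pairs of
  -- functions to the supports.
  have key : ∀ X : Submodule ℝ (LpUnit p), ∀ C, MeasurableSet C →
      (∀ f ∈ X, unitMeasure ({t | f t ≠ 0} ∩ C) = 0) → unitMeasure (supp X ∩ C) = 0 := by
    intro X C hC h
    have hX : IsSupp X (supp X) := (exists_isSupp X).choose_spec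
    have h1 : SuppSubset X (supp X \ C) := by
      refine ⟨hX.1.1.diff hC, sdiff_subset.trans hX.1.2.1, fun f hf => ?_⟩
      refine measure_mono_null (fun t ht => ?_) (measure_union_null (hX.1.2.2 f hf) (h f hf))
      by_cases htA : t ∈ supp X
      · exact Or.inr ⟨ht.1, by_contra fun htC => ht.2 ⟨htA, htC⟩⟩
      · exact Or.inl ⟨ht.1, htA⟩
    refine measure_mono_null (fun t ht => ?_) (hX.2 _ h1)
    exact ⟨ht.1, fun h' => h'.2 ht.2⟩
  have hX : IsSupp X (supp X) := (exists_isSupp X).choose_spec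
  have hY : IsSupp Y (supp Y) := (exists_isSupp Y).choose_spec
  constructor
  · intro h f hf g hg
    refine measure_mono_null (fun t ht => ?_)
      (measure_union_null h (measure_union_null (hX.1.2.2 f hf) (hY.1.2.2 g hg)))
    by_cases h1 : t ∈ supp X
    · by_cases h2 : t ∈ supp Y
      · exact Or.inl ⟨h1, h2⟩
      · exact Or.inr (Or.inr ⟨ht.2, h2⟩)
    · exact Or.inr (Or.inl ⟨ht.1, h1⟩)
  · intro h
    refine key X _ hY.1.1 fun f hf => ?_
    rw [inter_comm]
    refine key Y _ (measurableSet_support f) fun g hg => ?_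
    rw [inter_comm]
    exact h f hf g hg

end Overlap

/-! ### Non-triviality of `L_p^{n,0}` -/

/-- Level `n ≥ 1` has at least two intervals; the difference of two of their indicators is nonzero
with mean zero. -/
theorem exists_ne_zero_mem_LpLevelZero (p : ℝ≥0∞) [Fact (1 ≤ p)] {n : ℕ} (hn : 1 ≤ n) :
    ∃ f ∈ LpLevelZero p n, f ≠ 0 := by
  have h2 : 1 < 2 ^ n := Nat.one_lt_two_pow (by omega)
  let I : Dyadic := ⟨n, ⟨0, by omega⟩⟩
  let J : Dyadic := ⟨n, ⟨1, h2⟩⟩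
  have hIJ : Disjoint I.toSet J.toSet := Dyadic.disjoint_of_level_eq rfl (by simp [I, J])
  let e : Dyadic → LpUnit p := fun K =>
    indicatorConstLp p K.measurableSet_toSet (measure_ne_top unitMeasure K.toSet) (1 : ℝ)
  have hint : ∀ K : Dyadic, ∫ t, e K t ∂unitMeasure = 1 / 2 ^ K.level := by
    intro K
    have hK : 0 ≤ K.right - K.left := (sub_pos.2 K.left_lt_right).le
    rw [integral_indicatorConstLp, Measure.real, K.unitMeasure_toSet, ENNReal.toReal_ofReal hK,
      K.right_sub_left, smul_eq_mul, mul_one]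
  refine ⟨e I - e J, ⟨sub_mem (Submodule.subset_span ⟨I, rfl, rfl⟩)
    (Submodule.subset_span ⟨J, rfl, rfl⟩), ?_⟩, fun h => ?_⟩
  · change ∫ t, (e I - e J : LpUnit p) t ∂unitMeasure = 0
    rw [integral_congr_ae (Lp.coeFn_sub (e I) (e J))]
    simp only [Pi.sub_apply]
    rw [integral_sub ((Lp.memLp _).integrable Fact.out) ((Lp.memLp _).integrable Fact.out),
      hint, hint, sub_self]
  · have h0 : ∀ᵐ t ∂unitMeasure, t ∉ I.toSet := by
      have hI : e I =ᵐ[unitMeasure] I.toSet.indicator fun _ => (1 : ℝ) := indicatorConstLp_coeFn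
      have hJ : e J =ᵐ[unitMeasure] J.toSet.indicator fun _ => (1 : ℝ) := indicatorConstLp_coeFn
      rw [sub_eq_zero.1 h] at hI
      filter_upwards [hI, hJ] with t h1 h2 ht
      rw [h1, indicator_of_mem ht, indicator_of_notMem (Set.disjoint_left.1 hIJ ht)] at h2
      exact one_ne_zero h2
    have h1 : unitMeasure I.toSet = 0 := measure_eq_zero_iff_ae_notMem.2 h0
    rw [I.unitMeasure_toSet, ENNReal.ofReal_eq_zero] at h1
    exact absurd (sub_pos.2 I.left_lt_right) (not_lt.2 h1)

/-! ### Combinatorics of the trees -/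

theorem kappa_of_isSuccLimit {α : Ordinal.{0}} (h : Order.IsSuccLimit α) : kappa α = 0 :=
  Ordinal.limitRecOn_limit _ _ _ _ h

theorem kappa_natCast (n : ℕ) : kappa n = n := by
  induction n with
  | zero => exact Ordinal.limitRecOn_zero _ _ _
  | succ n ih =>
    rw [Nat.cast_succ, kappa, Ordinal.limitRecOn_add_one]
    exact congrArg (· + 1) ih

theorem Tree.exists_eq_cons {α : Ordinal.{0}} {l : List Entry} (h : Tree α l) :
    ∃ s, l = .ord α :: s := by
  cases h <;> exact ⟨_, rfl⟩

/-- Sequences end only at positive finite ordinals or infinite successors, never at `0` or a limit.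
-/
theorem Tree.one_le_lastKappa {α : Ordinal.{0}} {l : List Entry} (h : Tree α l) :
    1 ≤ lastKappa l := by
  induction h with
  | finite n hn => simpa [lastKappa, kappa_natCast] using hn
  | limit _ _ _ hs ih =>
    obtain ⟨s, rfl⟩ := hs.exists_eq_cons
    simpa [lastKappa] using ih
  | head _ _ hκ => simpa [lastKappa] using hκ
  | branch _ _ _ _ hs ih =>
    obtain ⟨s, rfl⟩ := hs.exists_eq_cons
    simpa [lastKappa] using ih

theorem lastKappa_cons_cons (a b : Entry) (s : List Entry) :
    lastKappa (a :: b :: s) = lastKappa (b :: s) := by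
  simp [lastKappa]

section Separation

variable {p : ℝ≥0∞} {T : Ordinal.{0} → Ordinal.{0} → LpUnit p →ₗ[ℝ] LpUnit p}

theorem treeOp_limit {α β : Ordinal.{0}} {s : List Entry} (hs : Tree β s) :
    treeOp T (.ord α :: s) = T α β ∘ₗ treeOp T s := by
  obtain ⟨s, rfl⟩ := hs.exists_eq_cons
  rfl

theorem treeOp_branch (α : Ordinal.{0}) (I : Dyadic) (s : List Entry) :
    treeOp T (.ord α :: .itv I :: s) = compress p I ∘ₗ treeOp T s := rfl

theorem Tree.preservesDisjointness (hT : IsIndependentSystem T) {α : Ordinal.{0}}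
    {l : List Entry} (h : Tree α l) (hα : α < ω₁) : PreservesDisjointness (treeOp T l) := by
  induction h with
  | finite n hn => exact .id
  | limit hlim h1 hβ hs ih =>
    rw [treeOp_limit hs]
    exact (hT.embedding _ hα hlim _ hβ).preservesDisjointness.comp (ih (hβ.trans hα))
  | head => exact .id
  | branch hβ hα' hκ hI hs ih =>
    rw [treeOp_branch]
    refine (preservesDisjointness_compress _).comp (ih (lt_of_le_of_lt ?_ hα))
    rw [hα']
    exact le_self_add

variable [Fact (1 ≤ p)]

theorem XSpace_limit {α β : Ordinal.{0}} {s : List Entry} (hs : Tree β s) :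
    XSpace T (.ord α :: s) = (XSpace T s).map (T α β) := by
  have h : lastKappa (.ord α :: s) = lastKappa s := by
    obtain ⟨s, rfl⟩ := hs.exists_eq_cons
    exact lastKappa_cons_cons _ _ _
  rw [XSpace, h, treeOp_limit hs, Submodule.map_comp, XSpace]

theorem XSpace_branch {α β : Ordinal.{0}} {I : Dyadic} {s : List Entry} (hs : Tree β s) :
    XSpace T (.ord α :: .itv I :: s) = (XSpace T s).map (compress p I) := by
  have h : lastKappa (.ord α :: .itv I :: s) = lastKappa s := by
    obtain ⟨s, rfl⟩ := hs.exists_eq_cons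
    rw [lastKappa_cons_cons, lastKappa_cons_cons]
  rw [XSpace, h, treeOp_branch, Submodule.map_comp, XSpace]

theorem Tree.exists_ne_zero_mem_XSpace (hT : IsIndependentSystem T) {α : Ordinal.{0}}
    {l : List Entry} (h : Tree α l) (hα : α < ω₁) : ∃ f ∈ XSpace T l, f ≠ 0 := by
  obtain ⟨f, hf, hf0⟩ := exists_ne_zero_mem_LpLevelZero p h.one_le_lastKappa
  exact ⟨_, Submodule.mem_map_of_mem hf, (h.preservesDisjointness hT hα).map_ne_zero hf0⟩

theorem disjointlySupported_iff {s t : List Entry} :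
    DisjointlySupported T s t ↔ ∀ f ∈ XSpace T s, ∀ g ∈ XSpace T t, overlap f g = 0 :=
  supp_inter_supp_null_iff _ _

/-- Strips a shared outermost operator `S` in the induction. -/
theorem disjointlySupported_congr_of_map {s t s' t' : List Entry}
    {S : LpUnit p →ₗ[ℝ] LpUnit p} (hS : PreservesDisjointness S)
    (hs : XSpace T s' = (XSpace T s).map S) (ht : XSpace T t' = (XSpace T t).map S) :
    DisjointlySupported T s' t' ↔ DisjointlySupported T s t := by
  simp only [disjointlySupported_iff, hs, ht, Submodule.mem_map, forall_exists_index, and_imp,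
    forall_apply_eq_imp_iff₂, hS _ _]

end Separation

/-- At the first place where they differ, `l` and `m` have entries of the same kind, and these are
intervals if and only if `D` holds. -/
def FirstDifference (D : Prop) (l m : List Entry) : Prop :=
  ∃ i₀ : ℕ, IsLeast {i | l[i]? ≠ m[i]?} i₀ ∧
    ((∃ β γ : Ordinal.{0}, l[i₀]? = some (.ord β) ∧ m[i₀]? = some (.ord γ)) ∨
      (∃ I J : Dyadic, l[i₀]? = some (.itv I) ∧ m[i₀]? = some (.itv J))) ∧
    (D ↔ ∃ I J : Dyadic, l[i₀]? = some (.itv I) ∧ m[i₀]? = some (.itv J))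

theorem FirstDifference.cons {D : Prop} {l m : List Entry} (h : FirstDifference D l m)
    (a : Entry) : FirstDifference D (a :: l) (a :: m) := by
  obtain ⟨i, ⟨hi, hmin⟩, h1, h2⟩ := h
  refine ⟨i + 1, ⟨by simpa using hi, fun j hj => ?_⟩, by simpa using h1, by simpa using h2⟩
  cases j with
  | zero => simp at hj
  | succ j => exact Nat.succ_le_succ (hmin (by simpa using hj))

theorem firstDifference_ord {D : Prop} (hD : ¬ D) {β γ : Ordinal.{0}} (h : β ≠ γ)
    (l m : List Entry) : FirstDifference D (.ord β :: l) (.ord γ :: m) :=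
  ⟨0, ⟨by simpa using h, fun _ _ => Nat.zero_le _⟩, by simp, by simpa using hD⟩

theorem firstDifference_itv {D : Prop} (hD : D) {I J : Dyadic} (h : I ≠ J)
    (l m : List Entry) : FirstDifference D (.itv I :: l) (.itv J :: m) :=
  ⟨0, ⟨by simpa using h, fun _ _ => Nat.zero_le _⟩, by simp, by simpa using hD⟩

theorem Incomparable.of_cons {a : Entry} {l m : List Entry}
    (h : Incomparable (a :: l) (a :: m)) : Incomparable l m := by
  simpa only [Incomparable, List.prefix_cons_inj] using h

theorem Tree.firstDifference {p : ℝ≥0∞} [Fact (1 ≤ p)]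
    {T : Ordinal.{0} → Ordinal.{0} → LpUnit p →ₗ[ℝ] LpUnit p} (hT : IsIndependentSystem T)
    {α : Ordinal.{0}} (hα : α < ω₁) {l m : List Entry} (hl : Tree α l) (hm : Tree α m)
    (hlm : Incomparable l m) : FirstDifference (DisjointlySupported T l m) l m := by
  -- `(α)` is an initial segment of every member of its tree, so incomparability rules out every
  -- case with a one-term sequence.
  have hsingle : ∀ {α : Ordinal.{0}} {m : List Entry}, Tree α m → [Entry.ord α] <+: m := by
    intro α m hm
    obtain ⟨s, rfl⟩ := hm.exists_eq_cons
    exact ⟨s, rfl⟩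
  induction hl generalizing m with
  | finite n hn => exact absurd (hsingle hm) hlm.1
  | head => exact absurd (hsingle hm) hlm.1
  | @limit α β s hlim h1 hβ hs ih =>
    cases hm with
    | finite n hn => exact absurd (hsingle (hs.limit hlim h1 hβ)) hlm.2
    | head => exact absurd (hsingle (hs.limit hlim h1 hβ)) hlm.2
    | branch _ _ hκ => rw [kappa_of_isSuccLimit hlim] at hκ; omega
    | @limit _ γ t _ h1' hγ ht =>
      by_cases hβγ : β = γ
      · subst hβγ
        have h := ih (hβ.trans hα) ht hlm.of_cons
        rw [← disjointlySupported_congr_of_map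
          (hT.embedding _ hα hlim _ hβ).preservesDisjointness (XSpace_limit hs)
          (XSpace_limit ht)] at h
        exact h.cons _
      · have hD : ¬ DisjointlySupported T (.ord α :: s) (.ord α :: t) := by
          obtain ⟨f, hf, hf0⟩ := hs.exists_ne_zero_mem_XSpace hT (hβ.trans hα)
          obtain ⟨g, hg, hg0⟩ := ht.exists_ne_zero_mem_XSpace hT (hγ.trans hα)
          rw [disjointlySupported_iff, XSpace_limit hs, XSpace_limit ht]
          intro h
          -- Only the coordinates `β` and `γ` of the family matter; the value `g` at the other
          -- indices is a filler.
          have hind := (hT.independent α hα hlim fun δ => if (δ : Ordinal) = β then f else g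
            ).indepFun (i := ⟨β, hβ⟩) (j := ⟨γ, hγ⟩) (fun h => hβγ (congrArg Subtype.val h))
          simp only [if_true, if_neg (Ne.symm hβγ)] at hind
          exact overlap_ne_zero_of_indepFun hind
            ((hT.embedding _ hα hlim _ hβ).preservesDisjointness.map_ne_zero hf0)
            ((hT.embedding _ hα hlim _ hγ).preservesDisjointness.map_ne_zero hg0)
            (h _ (Submodule.mem_map_of_mem hf) _ (Submodule.mem_map_of_mem hg))
        obtain ⟨s, rfl⟩ := hs.exists_eq_cons
        obtain ⟨t, rfl⟩ := ht.exists_eq_cons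
        exact (firstDifference_ord hD hβγ _ _).cons _
  | @branch α β I s hβ hα' hκ hI hs ih =>
    cases hm with
    | finite n hn => exact absurd (hsingle (hs.branch hβ hα' hκ hI)) hlm.2
    | head => exact absurd (hsingle (hs.branch hβ hα' hκ hI)) hlm.2
    | limit hlim => rw [kappa_of_isSuccLimit hlim] at hκ; omega
    | @branch _ γ J t hγ hα'' _ hJ ht =>
      -- Ordinal addition cancels on the right here because the summand `kappa α` is finite.
      obtain rfl : β = γ := (Ordinal.add_right_cancel (kappa α)).1 (hα'.symm.trans hα'')
      by_cases hIJ : I = J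
      · subst hIJ
        have hβα : β ≤ α := by rw [hα']; exact le_self_add
        have h := ih (hβα.trans_lt hα) ht hlm.of_cons.of_cons
        rw [← disjointlySupported_congr_of_map (preservesDisjointness_compress I)
          (XSpace_branch (α := α) hs) (XSpace_branch (α := α) ht)] at h
        exact (h.cons _).cons _
      · refine (firstDifference_itv ?_ hIJ _ _).cons _
        rw [disjointlySupported_iff, XSpace_branch hs, XSpace_branch ht]
        rintro _ ⟨f, -, rfl⟩ _ ⟨g, -, rfl⟩
        exact overlap_compress_eq_zero
          (Dyadic.disjoint_of_level_eq (hI.trans hJ.symm) hIJ) f g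

end BRS

theorem mainTheorem9 (p : ℝ≥0∞) [Fact (1 ≤ p)] (hp : 1 < p) (hp' : p < ∞)
    (T : Ordinal.{0} → Ordinal.{0} → BRS.LpUnit p →ₗ[ℝ] BRS.LpUnit p)
    (hT : BRS.IsIndependentSystem T)
    (α : Ordinal.{0}) (hα₁ : 1 ≤ α) (hα : α < ω₁)
    (l m : List BRS.Entry) (hl : BRS.Tree α l) (hm : BRS.Tree α m)
    (hlm : BRS.Incomparable l m) :
    ∃ i₀ : ℕ, IsLeast {i | l[i]? ≠ m[i]?} i₀ ∧
      ((∃ β γ : Ordinal.{0}, l[i₀]? = some (.ord β) ∧ m[i₀]? = some (.ord γ)) ∨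
        (∃ I J : BRS.Dyadic, l[i₀]? = some (.itv I) ∧ m[i₀]? = some (.itv J))) ∧
      (BRS.DisjointlySupported T l m ↔
        ∃ I J : BRS.Dyadic, l[i₀]? = some (.itv I) ∧ m[i₀]? = some (.itv J)) :=
  hl.firstDifference hT hα hm hlm
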